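/- **Setting.** Let $\mathcal A=\{A_0,\dots,A_d\}$ be a commutative association scheme (not necessarily symmetric) with $d$ classes on a finite vertex set $V$, $|V|=v$: the $A_i$ are nonzero $01$-matrices with $A_0=I$, $\sum_i A_i=J$, closed under transposition, pairwise commuting, with every $A_iA_j$ in the span of $A_0,\dots,A_d$. Let $E_0=\frac1vJ,E_1,\dots,E_d$ be its principal idempotents, i.e. the nonzero, pairwise orthogonal, Hermitian idempotents with sum $I$ in the span of the $A_i$. Suppose that $\mathcal A$ is a translation scheme: an abelian group $\Gamma$ (written additively) of permutations of $V$, transitive on $V$, preserves every $A_i$. Fixing a base vertex $o\in V$ identifies $g\in\Gamma$ with the vertex $g+o$. *The scheme $H(n,\mathcal A)$.* For $u,w\in V^n$ let $h(u,w)=(h_0,\dots,h_d)$, where $h_r$ is the number of coordinates $k$ such that $u_k,w_k$ are $r$-related. For $\alpha\in\mathbb Z_{\ge0}^{d+1}$ with $|\alpha|:=\sum_r\alpha_r=n$, let $A_\alpha$ be the $01$-matrix on $V^n$ with $(A_\alpha)_{u,w}=1$ iff $h(u,w)=\alpha$, and let $E_\alpha$ be the sum of all products $E_{i_1}\otimes\cdots\otimes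 E_{i_n}$ in which each $E_r$ occurs exactly $\alpha_r$ times. For a nonempty $C\subseteq V^n$ with characteristic vector $x$, the weight enumerator and the dual weight enumerator are $$W_C(t)=\frac1{|C|}\sum_{|\alpha|=n}(x^TA_\alpha x)\,t^\alpha,\qquad W_C^\perp(t)=\frac{v^n}{|C|^2}\sum_{|\beta|=n}(x^TE_\beta x)\,t^\beta,\qquad t^\alpha=\prod_{r=0}^d t_r^{\alpha_r}.$$ *Duals.* Fix a base vertex $b\in V^n$. The set $C\subseteq V^n$ is additive if $\{g\in\Gamma^n: g+b\in C\}$ is a subgroup of $\Gamma^n$. Let $\Gamma^*$ be the group of complex characters of $\Gamma$, and identify $(\Gamma^*)^n$ with the character group of $\Gamma^n$ by $\chi(g)=\prod_k\chi_k(g_k)$. The dual of $C$ is $$C^\perp=\{\chi\in(\Gamma^*)^n:\ \chi(g)=1\text{ for all }g\in\Gamma^n\text{ with }g+b\in C\}.$$ The dual $\mathcal A^*$ of $\mathcal A$ has vertex set $\Gamma^*$; the characters $\chi,\psi$ are $j$-related in $\mathcal A^*$ iff $E_j(\chi\psi^{-1})=\chi\psi^{-1}$, where characters are regarded as functions on $V$.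 The dual $C^\perp$ is a set of vertices of $H(n,\mathcal A^*)$. **Theorem.** (1) $\mathcal A^*$ is a commutative association scheme with $d$ classes on $\Gamma^*$. (2) For every $n\ge0$, every base vertex $b\in V^n$ and every additive subset $C$ of $H(n,\mathcal A)$, $$W_{C^\perp}(t)=W^\perp_C(t),$$ where $W_{C^\perp}$ is the weight enumerator of $C^\perp$ in $H(n,\mathcal A^*)$. (3) In particular, let $\varphi:\Gamma^*\to\Gamma$ be a group isomorphism such that, for all $j$, the characters $\chi,\psi$ are $j$-related in $\mathcal A^*$ iff the vertices $\varphi(\chi)+o$ and $\varphi(\psi)+o$ are $j$-related in $\mathcal A$. Identify $C^\perp$ with the subset $\{(\varphi(\chi_k)+b_k)_{k}:\chi\in C^\perp\}$ of the vertices of $H(n,\mathcal A)$. Then the equality in (2) also holds when $W_{C^\perp}$ is computed in $H(n,\mathcal A)$. -/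

import Mathlib

namespace TranslationDuality

open Matrix

open Classical in
/-- `A 0, …, A d` are the (nonempty) relations, as `01`-matrices, of a commutative association
scheme with `d` classes on `V`. The scheme need not be symmetric. -/
structure IsAssociationScheme {V : Type*} [Fintype V] {d : ℕ}
    (A : Fin (d + 1) → Matrix V V ℂ) : Prop where
  zero_or_one : ∀ i u w, A i u w = 0 ∨ A i u w = 1
  ne_zero : ∀ i, A i ≠ 0
  zero_eq_one : A 0 = 1
  sum_eq : ∑ i, A i = Matrix.of fun _ _ => (1 : ℂ)
  transpose_mem : ∀ i, ∃ j, (A i)ᵀ = A j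
  mul_eq : ∃ p : Fin (d + 1) → Fin (d + 1) → Fin (d + 1) → ℂ,
    ∀ i j, A i * A j = ∑ r, p i j r • A r
  mul_comm : ∀ i j, A i * A j = A j * A i

/-- The Bose–Mesner algebra, as a complex vector space of matrices. -/
def boseMesner {V : Type*} {d : ℕ} (A : Fin (d + 1) → Matrix V V ℂ) :
    Submodule ℂ (Matrix V V ℂ) :=
  Submodule.span ℂ (Set.range A)

open Classical in
/-- `E 0, …, E d` is an enumeration of the principal idempotents of the scheme `A`, starting
with `J / v`: nonzero, pairwise orthogonal, orthogonal projections in the Bose–Mesner algebra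
with sum `I`. Since there are `d + 1` of them, they are a basis of that algebra. -/
structure IsPrincipalIdempotents {V : Type*} [Fintype V] {d : ℕ}
    (A E : Fin (d + 1) → Matrix V V ℂ) : Prop where
  mem : ∀ j, E j ∈ boseMesner A
  ne_zero : ∀ j, E j ≠ 0
  isHermitian : ∀ j, (E j).IsHermitian
  zero_eq : E 0 = Matrix.of fun _ _ => (1 / (Fintype.card V : ℂ))
  sum_eq : ∑ j, E j = 1
  mul_self : ∀ j, E j * E j = E j
  mul_of_ne : ∀ i j, i ≠ j → E i * E j = 0

/-- The group `Γ`, written additively, acts on `V` by automorphisms of every relation of `A`. -/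
def ActsByAutomorphisms (Γ : Type*) {V : Type*} [AddCommGroup Γ] [AddAction Γ V] {d : ℕ}
    (A : Fin (d + 1) → Matrix V V ℂ) : Prop :=
  ∀ (g : Γ) i u w, A i (g +ᵥ u) (g +ᵥ w) = A i u w

/-! ### The scheme `H(n, A)` and the two weight enumerators -/

open Classical in
/-- The vector `h(v, w)`: its `r`-th entry is the number of coordinates `k` such that `v k` and
`w k` are `r`-related. -/
noncomputable def relCount {V : Type*} {d n : ℕ} (A : Fin (d + 1) → Matrix V V ℂ)
    (v w : Fin n → V) : Fin (d + 1) → ℕ :=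
  fun r => (Finset.univ.filter fun k => A r (v k) (w k) = 1).card

open Classical in
/-- The matrix `A_α` of `H(n, A)`: the `(v, w)` entry is `1` iff `h(v, w) = α`. -/
noncomputable def hammingMatrix {V : Type*} {d : ℕ} (n : ℕ) (A : Fin (d + 1) → Matrix V V ℂ)
    (α : Fin (d + 1) → ℕ) : Matrix (Fin n → V) (Fin n → V) ℂ :=
  Matrix.of fun v w => if relCount A v w = α then 1 else 0

open Classical in
/-- The matrix `E_β`: the sum of all tensor products `E (i 1) ⊗ ⋯ ⊗ E (i n)` in which `E r`
occurs exactly `β r` times, for each `r`. -/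
noncomputable def hammingIdempotent {V : Type*} {d : ℕ} (n : ℕ) (E : Fin (d + 1) → Matrix V V ℂ)
    (β : Fin (d + 1) → ℕ) : Matrix (Fin n → V) (Fin n → V) ℂ :=
  ∑ i ∈ Finset.univ.filter
      (fun i : Fin n → Fin (d + 1) => ∀ r, (Finset.univ.filter fun k => i k = r).card = β r),
    Matrix.of fun v w => ∏ k, E (i k) (v k) (w k)

/-- The characteristic vector of a set of vertices. -/
noncomputable def charVec {W : Type*} (C : Set W) : W → ℂ :=
  C.indicator fun _ => 1

/-- The weight enumerator `W_C` of a set `C` of vertices of `H(n, A)`. -/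
noncomputable def weightEnumerator {V : Type*} [Fintype V] {d n : ℕ}
    (A : Fin (d + 1) → Matrix V V ℂ) (C : Set (Fin n → V)) : MvPolynomial (Fin (d + 1)) ℂ :=
  MvPolynomial.C (1 / (C.ncard : ℂ)) *
    ∑ α ∈ Finset.piAntidiag Finset.univ n,
      MvPolynomial.C (charVec C ⬝ᵥ (hammingMatrix n A α *ᵥ charVec C)) *
        ∏ r, MvPolynomial.X r ^ α r

/-- The dual weight enumerator `W_C^⊥` of a set `C` of vertices of `H(n, A)`, where `E` is the
family of principal idempotents of `A`. -/
noncomputable def dualWeightEnumerator {V : Type*} [Fintype V] {d n : ℕ}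
    (E : Fin (d + 1) → Matrix V V ℂ) (C : Set (Fin n → V)) : MvPolynomial (Fin (d + 1)) ℂ :=
  MvPolynomial.C ((Fintype.card V : ℂ) ^ n / (C.ncard : ℂ) ^ 2) *
    ∑ β ∈ Finset.piAntidiag Finset.univ n,
      MvPolynomial.C (charVec C ⬝ᵥ (hammingIdempotent n E β *ᵥ charVec C)) *
        ∏ r, MvPolynomial.X r ^ β r

/-! ### Translation schemes, additive sets and duals

`Γ` acts regularly on `V`, and `g : Γ` is identified with the vertex `g +ᵥ o`. -/

/-- The set of vertices `C` of `H(n, A)` is additive relative to `Γ ^ n` and the base vertex `b`: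
the set of `g` in `Γ ^ n` with `g +ᵥ b ∈ C` is a subgroup. -/
def IsAdditive (Γ : Type*) {V : Type*} [AddCommGroup Γ] [AddAction Γ V] {n : ℕ}
    (b : Fin n → V) (C : Set (Fin n → V)) : Prop :=
  ∃ H : AddSubgroup (Fin n → Γ), ∀ g : Fin n → Γ, g ∈ H ↔ (fun k => g k +ᵥ b k) ∈ C

/-- The dual `C^⊥`: the set of characters of `Γ ^ n` that are trivial on (the image in `Γ ^ n` of)
`C`. A character of `Γ ^ n` is written as the tuple `χ` of its components, so that its value
at `g` is `∏ k, χ k (g k)`. -/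
def dualSet (Γ : Type*) {V : Type*} [AddCommGroup Γ] [AddAction Γ V] {n : ℕ}
    (b : Fin n → V) (C : Set (Fin n → V)) : Set (Fin n → AddChar Γ ℂ) :=
  {χ | ∀ g : Fin n → Γ, (fun k => g k +ᵥ b k) ∈ C → ∏ k, χ k (g k) = 1}

/-- The set `D` of characters of `Γ` that, as functions on `V ≅ Γ`, are fixed by the matrix `M`:
`M χ = χ`. -/
noncomputable def dualClass {Γ V : Type*} [AddCommGroup Γ] [Finite Γ] [AddAction Γ V]
    (o : V) (M : Matrix V V ℂ) : Set (AddChar Γ ℂ) :=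
  {χ | ∀ g : Γ, ∑ᶠ h : Γ, M (g +ᵥ o) (h +ᵥ o) * χ h = χ g}

open Classical in
/-- The dual translation scheme on the character group of `Γ`: the characters `χ`, `ψ` are
`j`-related iff `χ ψ⁻¹` is, as a function on `V`, in the `j`-th eigenspace (the column space
of `E j`). -/
noncomputable def dualScheme (Γ : Type*) {V : Type*} [AddCommGroup Γ] [Finite Γ] [AddAction Γ V]
    {d : ℕ} (o : V) (E : Fin (d + 1) → Matrix V V ℂ) :
    Fin (d + 1) → Matrix (AddChar Γ ℂ) (AddChar Γ ℂ) ℂ :=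
  fun j => Matrix.of fun χ ψ => if χ * ψ⁻¹ ∈ dualClass o (E j) then 1 else 0

/-- The set of vertices of `H(n, A)` that corresponds to a set `D` of `n`-tuples of characters of
`Γ` under an identification `φ` of the character group of `Γ` with `Γ`. -/
def vertexSet {Γ V : Type*} [AddCommGroup Γ] [AddAction Γ V] {n : ℕ}
    (b : Fin n → V) (φ : AddChar Γ ℂ ≃+ Γ) (D : Set (Fin n → AddChar Γ ℂ)) :
    Set (Fin n → V) :=
  (fun χ k => φ (χ k) +ᵥ b k) '' D

end TranslationDuality

namespace TranslationDuality

open Matrix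

/-! ### Fourier analysis of invariant matrices -/

section Fourier

variable {Γ V : Type*} [AddCommGroup Γ] [AddAction Γ V]

/-! `Γ` acts regularly, so an invariant matrix is a convolution operator on `Γ`: every character is
an eigenvector, with eigenvalue `fourierCoeff`. On the `E j` these eigenvalues are 0 or 1, and for
each `χ` exactly one is 1. This defines an index `c χ` (`IsDualIndex`), and `dualScheme` is the
partition of pairs by `c (χ * ψ⁻¹)`. The Bose–Mesner algebra is spanned by the `E j` and closed
under transposition and entrywise product; under the Fourier transform these become inversion and
convolution of characters, which gives the axioms of the dual scheme.

For the enumerators, both coefficients at `β` count the `χ` in the dual whose tuple of indices has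
type `β`. Since the dual is a group, `charVec_hammingMatrix_dualScheme` yields this count times its
order. Fourier inversion expands `E_β` in characters, and orthogonality over the subgroup
(`charVec_hammingIdempotent`) yields the same count times the square of the order of `C`. Part (3)
only transports relations along `φ`. -/

theorem vadd_bijective_of_faithful [FaithfulVAdd Γ V] [AddAction.IsPretransitive Γ V] (o : V) :
    Function.Bijective fun g : Γ => g +ᵥ o := by
  refine ⟨fun g h hgh => ?_, fun u => AddAction.exists_vadd_eq Γ o u⟩
  refine FaithfulVAdd.eq_of_vadd_eq_vadd fun u : V => ?_
  obtain ⟨x, rfl⟩ := AddAction.exists_vadd_eq Γ o u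
  rw [vadd_comm g x o, vadd_comm h x o]
  exact congrArg (x +ᵥ ·) hgh

/-- The matrix `M` is invariant under the simultaneous action of `Γ` on rows and columns. -/
def IsInvariant (Γ : Type*) {V : Type*} [AddCommGroup Γ] [AddAction Γ V] (M : Matrix V V ℂ) :
    Prop :=
  ∀ (g : Γ) u w, M (g +ᵥ u) (g +ᵥ w) = M u w

theorem IsInvariant.apply_vadd_vadd {M : Matrix V V ℂ} (hM : IsInvariant Γ M) (o : V) (g h : Γ) :
    M (g +ᵥ o) (h +ᵥ o) = M o ((h - g) +ᵥ o) := by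
  rw [← hM g o, vadd_vadd, add_sub_cancel]

/-- Commutativity of `Γ` makes the base vertex irrelevant; this lets the coordinates of `b` differ
from the `o` that defines the dual scheme. -/
theorem IsInvariant.apply_vadd_vadd_base [AddAction.IsPretransitive Γ V] {M : Matrix V V ℂ}
    (hM : IsInvariant Γ M) (o b : V) (g h : Γ) :
    M (g +ᵥ b) (h +ᵥ b) = M (g +ᵥ o) (h +ᵥ o) := by
  obtain ⟨x, rfl⟩ := AddAction.exists_vadd_eq Γ o b
  rw [vadd_comm g x o, vadd_comm h x o, hM]

theorem ActsByAutomorphisms.isInvariant_of_mem {d : ℕ} {A : Fin (d + 1) → Matrix V V ℂ}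
    (hΓ : ActsByAutomorphisms Γ A) {M : Matrix V V ℂ} (hM : M ∈ boseMesner A) :
    IsInvariant Γ M := by
  induction hM using Submodule.span_induction with
  | mem M h => obtain ⟨i, rfl⟩ := h; exact fun g u w => hΓ g i u w
  | zero => exact fun _ _ _ => rfl
  | add M N _ _ h1 h2 => exact fun g u w => by simp [h1 g u w, h2 g u w]
  | smul a M _ h => exact fun g u w => by simp [h g u w]

variable [Fintype Γ]

/-- The Fourier coefficient at `χ` of the row of `M` at the base vertex `o`. If `M` is invariant,
this is the eigenvalue of `M` at the eigenvector `χ`. -/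
noncomputable def fourierCoeff (o : V) (M : Matrix V V ℂ) (χ : AddChar Γ ℂ) : ℂ :=
  ∑ k : Γ, M o (k +ᵥ o) * χ k

theorem fourierCoeff_sum_smul {ι : Type*} (s : Finset ι) (c : ι → ℂ) (M : ι → Matrix V V ℂ)
    (o : V) (χ : AddChar Γ ℂ) :
    fourierCoeff o (∑ i ∈ s, c i • M i) χ = ∑ i ∈ s, c i * fourierCoeff o (M i) χ := by
  simp only [fourierCoeff, Matrix.sum_apply, Matrix.smul_apply, smul_eq_mul, Finset.sum_mul,
    Finset.mul_sum, mul_assoc]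
  exact Finset.sum_comm

theorem fourierCoeff_sum {ι : Type*} (s : Finset ι) (M : ι → Matrix V V ℂ)
    (o : V) (χ : AddChar Γ ℂ) :
    fourierCoeff o (∑ i ∈ s, M i) χ = ∑ i ∈ s, fourierCoeff o (M i) χ := by
  simpa using fourierCoeff_sum_smul s 1 M o χ

theorem fourierCoeff_zero (o : V) (χ : AddChar Γ ℂ) : fourierCoeff o 0 χ = 0 := by
  simp [fourierCoeff]

theorem fourierCoeff_transpose {M : Matrix V V ℂ} (hM : IsInvariant Γ M) (o : V)
    (χ : AddChar Γ ℂ) : fourierCoeff o Mᵀ χ = fourierCoeff o M χ⁻¹ := by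
  unfold fourierCoeff
  refine Fintype.sum_equiv (Equiv.neg Γ) _ _ fun k => ?_
  have := hM.apply_vadd_vadd o k 0
  rw [zero_vadd, zero_sub] at this
  simp [this]

/-- By `key`, `χ` is an eigenvector with eigenvalue `fourierCoeff o M χ`. -/
theorem mem_dualClass_iff {M : Matrix V V ℂ} (hM : IsInvariant Γ M) (o : V) (χ : AddChar Γ ℂ) :
    χ ∈ dualClass o M ↔ fourierCoeff o M χ = 1 := by
  have key : ∀ g : Γ, ∑ᶠ h : Γ, M (g +ᵥ o) (h +ᵥ o) * χ h = χ g * fourierCoeff o M χ := by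
    intro g
    rw [finsum_eq_sum_of_fintype, fourierCoeff, Finset.mul_sum]
    refine Fintype.sum_equiv (Equiv.subRight g) _ _ fun h => ?_
    rw [hM.apply_vadd_vadd, Equiv.subRight_apply, mul_left_comm, ← AddChar.map_add_eq_mul,
      add_sub_cancel]
  simp only [dualClass, Set.mem_ofPred_eq, key]
  exact ⟨fun h => by simpa using h 0, fun h g => by rw [h, mul_one]⟩

theorem card_mul_apply_eq_sum_fourierCoeff (M : Matrix V V ℂ) (o : V) (k : Γ) :
    (Fintype.card Γ : ℂ) * M o (k +ᵥ o) = ∑ χ : AddChar Γ ℂ, fourierCoeff o M χ * χ (-k) := by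
  classical
  simp only [fourierCoeff, Finset.sum_mul, mul_assoc, ← AddChar.map_add_eq_mul]
  rw [Finset.sum_comm]
  simp only [← Finset.mul_sum, AddChar.sum_apply_eq_ite, ← sub_eq_add_neg, sub_eq_zero]
  simp [mul_comm]

/-- The convolution theorem: expand the entries of `M` by Fourier inversion. -/
theorem card_mul_fourierCoeff_hadamard (M N : Matrix V V ℂ) (o : V) (χ : AddChar Γ ℂ) :
    (Fintype.card Γ : ℂ) * fourierCoeff o (M ⊙ N) χ =
      ∑ τ : AddChar Γ ℂ, fourierCoeff o M τ * fourierCoeff o N (χ * τ⁻¹) := by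
  conv_lhs => rw [fourierCoeff, Finset.mul_sum]
  conv_rhs => enter [2, τ]; rw [fourierCoeff.eq_def o N, Finset.mul_sum]
  rw [Finset.sum_comm]
  refine Finset.sum_congr rfl fun k _ => ?_
  rw [Matrix.hadamard_apply, ← mul_assoc, ← mul_assoc, card_mul_apply_eq_sum_fourierCoeff,
    Finset.sum_mul, Finset.sum_mul]
  refine Finset.sum_congr rfl fun τ _ => ?_
  rw [AddChar.mul_apply, AddChar.inv_apply]
  ring

theorem eq_zero_of_fourierCoeff_eq_zero [AddAction.IsPretransitive Γ V] {M : Matrix V V ℂ}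
    (hM : IsInvariant Γ M) (o : V) (h : ∀ χ : AddChar Γ ℂ, fourierCoeff o M χ = 0) : M = 0 := by
  ext u w
  obtain ⟨g, rfl⟩ := AddAction.exists_vadd_eq Γ o u
  obtain ⟨k, rfl⟩ := AddAction.exists_vadd_eq Γ o w
  have := card_mul_apply_eq_sum_fourierCoeff M o (k - g)
  simp only [h, zero_mul, Finset.sum_const_zero, mul_eq_zero, Nat.cast_eq_zero,
    Fintype.card_ne_zero, false_or] at this
  rw [hM.apply_vadd_vadd, this, Matrix.zero_apply]

theorem fourierCoeff_one [FaithfulVAdd Γ V] [AddAction.IsPretransitive Γ V] [DecidableEq V]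
    (o : V) (χ : AddChar Γ ℂ) :
    fourierCoeff o (1 : Matrix V V ℂ) χ = 1 := by
  rw [fourierCoeff, Finset.sum_eq_single 0]
  · rw [zero_vadd, one_apply_eq, AddChar.map_zero_eq_one, mul_one]
  · intro k _ hk
    have : o ≠ k +ᵥ o := fun h =>
      hk ((vadd_bijective_of_faithful (Γ := Γ) o).1 (by simpa using h.symm))
    simp [this]
  · simp

variable [Fintype V] [FaithfulVAdd Γ V] [AddAction.IsPretransitive Γ V]

theorem card_eq_of_regular (o : V) : Fintype.card V = Fintype.card Γ :=
  (Fintype.card_of_bijective (vadd_bijective_of_faithful (Γ := Γ) o)).symm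

theorem fourierCoeff_mul {M N : Matrix V V ℂ} (hN : IsInvariant Γ N)
    (o : V) (χ : AddChar Γ ℂ) :
    fourierCoeff o (M * N) χ = fourierCoeff o M χ * fourierCoeff o N χ := by
  have key : ∀ k : Γ, (M * N) o (k +ᵥ o) =
      ∑ h : Γ, M o (h +ᵥ o) * N o ((k - h) +ᵥ o) := by
    intro k
    rw [Matrix.mul_apply]
    refine ((vadd_bijective_of_faithful (Γ := Γ) o).sum_comp
      (fun u => M o u * N u (k +ᵥ o))).symm.trans ?_
    exact Finset.sum_congr rfl fun h _ => by rw [hN.apply_vadd_vadd]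
  simp only [fourierCoeff, key, Finset.sum_mul]
  rw [Finset.sum_comm]
  refine Finset.sum_congr rfl fun h _ => ?_
  rw [Finset.mul_sum]
  refine Fintype.sum_equiv (Equiv.subRight h) _ _ fun k => ?_
  have : χ k = χ h * χ (k - h) := by rw [← AddChar.map_add_eq_mul, add_sub_cancel]
  rw [this, Equiv.subRight_apply]
  ring

end Fourier

/-! ### The Bose–Mesner algebra: idempotent basis and entrywise product -/

section BoseMesner

variable {V : Type*} [Fintype V] {d : ℕ} {A E : Fin (d + 1) → Matrix V V ℂ}

/-- Nonzero orthogonal idempotents are independent, and `d + 1` of them fill a space spanned by `d +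
1` matrices. -/
theorem IsPrincipalIdempotents.span_eq (hE : IsPrincipalIdempotents A E) :
    Submodule.span ℂ (Set.range E) = boseMesner A := by
  have hli : LinearIndependent ℂ E := by
    rw [Fintype.linearIndependent_iff]
    intro c hc j
    have : (∑ i, c i • E i) * E j = c j • E j := by
      rw [Finset.sum_mul, Finset.sum_eq_single j]
      · rw [smul_mul_assoc, hE.mul_self]
      · intro i _ hij
        rw [smul_mul_assoc, hE.mul_of_ne i j hij, smul_zero]
      · simp
    rw [hc, zero_mul] at this
    exact (smul_eq_zero.1 this.symm).resolve_right (hE.ne_zero j)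
  refine Submodule.eq_of_le_of_finrank_le ?_ ?_
  · rw [Submodule.span_le]
    rintro _ ⟨j, rfl⟩
    exact hE.mem j
  · rw [finrank_span_eq_card hli]
    exact finrank_range_le_card A

theorem IsPrincipalIdempotents.exists_eq_sum (hE : IsPrincipalIdempotents A E)
    {M : Matrix V V ℂ} (hM : M ∈ boseMesner A) : ∃ c : Fin (d + 1) → ℂ, M = ∑ j, c j • E j := by
  rw [← hE.span_eq, Submodule.mem_span_range_iff_exists_fun] at hM
  obtain ⟨c, hc⟩ := hM
  exact ⟨c, hc.symm⟩

theorem IsAssociationScheme.transpose_mem_boseMesner (hA : IsAssociationScheme A)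
    {M : Matrix V V ℂ} (hM : M ∈ boseMesner A) : Mᵀ ∈ boseMesner A := by
  induction hM using Submodule.span_induction with
  | mem M h =>
    obtain ⟨i, rfl⟩ := h
    obtain ⟨j, hj⟩ := hA.transpose_mem i
    exact hj ▸ Submodule.subset_span ⟨j, rfl⟩
  | zero => simp
  | add M N _ _ h1 h2 => rw [transpose_add]; exact add_mem h1 h2
  | smul a M _ h => rw [transpose_smul]; exact Submodule.smul_mem _ _ h

theorem IsAssociationScheme.hadamard_eq (hA : IsAssociationScheme A) (i j : Fin (d + 1)) :
    A i ⊙ A j = if i = j then A i else 0 := by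
  ext u w
  split_ifs with hij
  · subst hij
    rcases hA.zero_or_one i u w with h | h <;> simp [h]
  · rw [hadamard_apply, Matrix.zero_apply]
    by_contra hne
    have hi := (hA.zero_or_one i u w).resolve_left (left_ne_zero_of_mul hne)
    have hj := (hA.zero_or_one j u w).resolve_left (right_ne_zero_of_mul hne)
    -- The entries are lifted to `ℕ`, where two ones contradict a total of 1.
    choose s hs using fun r => (show ∃ m : ℕ, A r u w = m from by
      rcases hA.zero_or_one r u w with h | h
      · exact ⟨0, by simp [h]⟩
      · exact ⟨1, by simp [h]⟩)
    have hsum : ∑ r, s r = 1 := by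
      have := congrFun (congrFun hA.sum_eq u) w
      simp only [Matrix.sum_apply, of_apply, hs] at this
      exact_mod_cast this
    have hi' : s i = 1 := by exact_mod_cast (hs i).symm.trans hi
    have hj' : s j = 1 := by exact_mod_cast (hs j).symm.trans hj
    have := Finset.sum_le_sum_of_subset (f := s) (Finset.subset_univ {i, j})
    rw [Finset.sum_pair hij] at this
    omega

theorem IsAssociationScheme.hadamard_mem_boseMesner (hA : IsAssociationScheme A)
    {M N : Matrix V V ℂ} (hM : M ∈ boseMesner A) (hN : N ∈ boseMesner A) :
    M ⊙ N ∈ boseMesner A := by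
  induction hM using Submodule.span_induction with
  | mem M h =>
    obtain ⟨i, rfl⟩ := h
    induction hN using Submodule.span_induction with
    | mem N h =>
      obtain ⟨j, rfl⟩ := h
      rw [hA.hadamard_eq]
      split_ifs
      · exact Submodule.subset_span ⟨i, rfl⟩
      · exact zero_mem _
    | zero => simp
    | add M N _ _ h1 h2 => rw [hadamard_add]; exact add_mem h1 h2
    | smul a M _ h => rw [hadamard_smul]; exact Submodule.smul_mem _ _ h
  | zero => simp
  | add M N _ _ h1 h2 => rw [add_hadamard]; exact add_mem h1 h2
  | smul a M _ h => rw [smul_hadamard]; exact Submodule.smul_mem _ _ h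

end BoseMesner

/-! ### The dual association scheme -/

section DualScheme

variable {Γ V : Type*} [AddCommGroup Γ] [AddAction Γ V] {d : ℕ} {A E : Fin (d + 1) → Matrix V V ℂ}

theorem IsPrincipalIdempotents.isInvariant [Fintype V] (hE : IsPrincipalIdempotents A E)
    (hΓ : ActsByAutomorphisms Γ A) (j : Fin (d + 1)) : IsInvariant Γ (E j) :=
  hΓ.isInvariant_of_mem (hE.mem j)

variable [Fintype Γ]

/-- `c χ` is the index of the eigenspace of the scheme that contains the character `χ`. -/
def IsDualIndex (o : V) (E : Fin (d + 1) → Matrix V V ℂ) (c : AddChar Γ ℂ → Fin (d + 1)) : Prop :=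
  ∀ j χ, fourierCoeff o (E j) χ = if c χ = j then 1 else 0

theorem dualScheme_apply (hinv : ∀ j, IsInvariant Γ (E j)) {o : V}
    {c : AddChar Γ ℂ → Fin (d + 1)} (hc : IsDualIndex o E c) (j : Fin (d + 1))
    (χ ψ : AddChar Γ ℂ) : dualScheme Γ o E j χ ψ = if c (χ * ψ⁻¹) = j then 1 else 0 := by
  classical
  rw [dualScheme, of_apply]
  refine if_congr ?_ rfl rfl
  rw [mem_dualClass_iff (hinv j), hc]
  split_ifs with h <;> simp [h]

theorem IsDualIndex.fourierCoeff_sum_smul {o : V} {c : AddChar Γ ℂ → Fin (d + 1)}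
    (hc : IsDualIndex o E c) (a : Fin (d + 1) → ℂ) (χ : AddChar Γ ℂ) :
    fourierCoeff o (∑ j, a j • E j) χ = a (c χ) := by
  simp [TranslationDuality.fourierCoeff_sum_smul, hc _ χ]

variable [Fintype V]

/-- The map `M ↦ fourierCoeff o M χ` is multiplicative on invariant matrices, so orthogonal
idempotents with sum `1` go to orthogonal idempotents of `ℂ` with sum 1. -/
theorem IsPrincipalIdempotents.exists_isDualIndex [FaithfulVAdd Γ V]
    [AddAction.IsPretransitive Γ V] (hE : IsPrincipalIdempotents A E)
    (hΓ : ActsByAutomorphisms Γ A) (o : V) :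
    ∃ c : AddChar Γ ℂ → Fin (d + 1), IsDualIndex o E c := by
  classical
  have hinv := hE.isInvariant hΓ
  have key : ∀ χ : AddChar Γ ℂ, ∃ i, ∀ j, fourierCoeff o (E j) χ = if i = j then 1 else 0 := by
    intro χ
    have hsum : ∑ j, fourierCoeff o (E j) χ = 1 := by
      rw [← fourierCoeff_sum, hE.sum_eq]
      convert fourierCoeff_one (Γ := Γ) o χ
    obtain ⟨i, -, hi⟩ := Finset.exists_ne_zero_of_sum_ne_zero (hsum.trans_ne one_ne_zero)
    refine ⟨i, fun j => ?_⟩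
    split_ifs with hij
    · subst hij
      have := fourierCoeff_mul (M := E i) (hinv i) o χ
      rw [hE.mul_self] at this
      exact (mul_eq_left₀ hi).1 this.symm
    · have := fourierCoeff_mul (M := E i) (hinv j) o χ
      rw [hE.mul_of_ne i j hij, fourierCoeff_zero] at this
      exact (mul_eq_zero.1 this.symm).resolve_left hi
  choose c hc using key
  exact ⟨c, fun j χ => hc χ j⟩

theorem IsDualIndex.surjective [AddAction.IsPretransitive Γ V]
    (hE : IsPrincipalIdempotents A E) (hΓ : ActsByAutomorphisms Γ A)
    {o : V} {c : AddChar Γ ℂ → Fin (d + 1)} (hc : IsDualIndex o E c) : Function.Surjective c := by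
  intro j
  by_contra! h
  exact hE.ne_zero j (eq_zero_of_fourierCoeff_eq_zero (hE.isInvariant hΓ j) o fun χ => by
    rw [hc, if_neg (h χ)])

theorem IsDualIndex.eq_zero_iff [FaithfulVAdd Γ V] [AddAction.IsPretransitive Γ V]
    (hE : IsPrincipalIdempotents A E) {o : V} {c : AddChar Γ ℂ → Fin (d + 1)}
    (hc : IsDualIndex o E c) (χ : AddChar Γ ℂ) : c χ = 0 ↔ χ = 1 := by
  classical
  have h := hc 0 χ
  simp only [fourierCoeff, hE.zero_eq, of_apply, ← Finset.mul_sum, AddChar.sum_eq_ite,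
    card_eq_of_regular (Γ := Γ) o] at h
  have h0 : (Fintype.card Γ : ℂ) ≠ 0 := Nat.cast_ne_zero.2 Fintype.card_ne_zero
  -- The trivial character is written both `1` and `0`; `AddChar.sum_eq_ite` uses the latter.
  change _ ↔ χ = 0
  split_ifs at h with h1 h2 h2 <;> simp_all

/-- The transpose of an idempotent is a combination of the `E j`, so its eigenvalue at `τ` depends
only on `c τ`. -/
theorem IsDualIndex.apply_inv_eq (hA : IsAssociationScheme A)
    (hE : IsPrincipalIdempotents A E) (hΓ : ActsByAutomorphisms Γ A)
    {o : V} {c : AddChar Γ ℂ → Fin (d + 1)} (hc : IsDualIndex o E c) {χ ψ : AddChar Γ ℂ}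
    (h : c χ = c ψ) : c χ⁻¹ = c ψ⁻¹ := by
  obtain ⟨a, ha⟩ := hE.exists_eq_sum (hA.transpose_mem_boseMesner (hE.mem (c ψ⁻¹)))
  have key : ∀ τ : AddChar Γ ℂ, (if c τ⁻¹ = c ψ⁻¹ then (1 : ℂ) else 0) = a (c τ) := fun τ => by
    rw [← hc, ← fourierCoeff_transpose (hE.isInvariant hΓ _), ha, hc.fourierCoeff_sum_smul]
  have := (key χ).trans ((congrArg a h).trans (key ψ).symm)
  by_contra hne
  simp [hne] at this

/-- The dual intersection numbers are Krein parameters: `card Γ` times the coefficients of `E i ⊙ E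
j` in the basis `E`. -/
theorem IsDualIndex.exists_card_eq [FaithfulVAdd Γ V] [AddAction.IsPretransitive Γ V]
    (hA : IsAssociationScheme A)
    (hE : IsPrincipalIdempotents A E)
    {o : V} {c : AddChar Γ ℂ → Fin (d + 1)} (hc : IsDualIndex o E c) (i j : Fin (d + 1)) :
    ∃ p : Fin (d + 1) → ℂ, ∀ χ : AddChar Γ ℂ,
      ∑ τ : AddChar Γ ℂ, (if c τ = i then (1 : ℂ) else 0) * (if c (χ * τ⁻¹) = j then 1 else 0) =
        p (c χ) := by
  obtain ⟨a, ha⟩ := hE.exists_eq_sum (hA.hadamard_mem_boseMesner (hE.mem i) (hE.mem j))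
  refine ⟨fun r => Fintype.card Γ * a r, fun χ => ?_⟩
  beta_reduce
  rw [← hc.fourierCoeff_sum_smul a χ, ← ha, card_mul_fourierCoeff_hadamard]
  simp only [hc i, hc j]

theorem isAssociationScheme_dualScheme [FaithfulVAdd Γ V] [AddAction.IsPretransitive Γ V]
    (hA : IsAssociationScheme A) (hE : IsPrincipalIdempotents A E)
    (hΓ : ActsByAutomorphisms Γ A) (o : V) : IsAssociationScheme (dualScheme Γ o E) := by
  classical
  obtain ⟨c, hc⟩ := hE.exists_isDualIndex hΓ o
  have happ := dualScheme_apply (hE.isInvariant hΓ) hc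
  have hmul : ∀ i j χ ψ, (dualScheme Γ o E i * dualScheme Γ o E j) χ ψ =
      ∑ τ : AddChar Γ ℂ, (if c τ = i then (1 : ℂ) else 0) *
        (if c ((χ * ψ⁻¹) * τ⁻¹) = j then 1 else 0) := by
    intro i j χ ψ
    simp only [mul_apply, happ]
    -- Substituting `τ ↦ χ * τ⁻¹` makes the sum depend on `χ * ψ⁻¹` alone.
    refine Fintype.sum_equiv ((Equiv.inv _).trans (Equiv.mulLeft χ)) _ _ fun τ => ?_
    simp only [Equiv.trans_apply, Equiv.inv_apply, Equiv.coe_mulLeft]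
    congr 4
    rw [mul_inv, inv_inv, mul_comm χ⁻¹, ← mul_assoc, mul_comm (χ * ψ⁻¹), mul_assoc]
    rw [mul_comm χ ψ⁻¹, mul_assoc, mul_inv_cancel, mul_one]
  refine ⟨fun i χ ψ => ?_, fun i h => ?_, ?_, ?_, fun i => ?_, ?_, fun i j => ?_⟩
  · rw [happ]; split_ifs <;> simp
  · obtain ⟨χ, hχ⟩ := hc.surjective hE hΓ i
    have := happ i χ 1
    simp [h, hχ] at this
  · ext χ ψ
    rw [happ, one_apply]
    exact if_congr ((hc.eq_zero_iff hE _).trans mul_inv_eq_one) rfl rfl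
  · ext χ ψ
    simp [Matrix.sum_apply, happ]
  · obtain ⟨χ₀, rfl⟩ := hc.surjective hE hΓ i
    refine ⟨c χ₀⁻¹, ?_⟩
    ext χ ψ
    rw [transpose_apply, happ, happ]
    refine if_congr ⟨fun h => ?_, fun h => ?_⟩ rfl rfl
    · simpa using hc.apply_inv_eq hA hE hΓ h
    · simpa using hc.apply_inv_eq hA hE hΓ h
  · choose p hp using hc.exists_card_eq hA hE
    refine ⟨p, fun i j => ?_⟩
    ext χ ψ
    rw [hmul, hp]
    simp [Matrix.sum_apply, happ]
  · ext χ ψ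
    rw [hmul, hmul]
    -- The reflection `τ ↦ (χ * ψ⁻¹) * τ⁻¹` swaps the two factors.
    refine Fintype.sum_equiv ((Equiv.inv _).trans (Equiv.mulLeft (χ * ψ⁻¹))) _ _ fun τ => ?_
    simp only [Equiv.trans_apply, Equiv.inv_apply, Equiv.coe_mulLeft]
    rw [mul_comm]
    congr 4
    rw [mul_inv, inv_inv, mul_inv_cancel_left]

end DualScheme

/-! ### Quadratic forms of characteristic vectors, and transport of enumerators -/

open Classical in
theorem charVec_dotProduct_mulVec {W : Type*} [Fintype W] (C : Set W) (M : Matrix W W ℂ) :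
    charVec C ⬝ᵥ (M *ᵥ charVec C) =
      ∑ u, ∑ w, (if u ∈ C then 1 else 0) * (if w ∈ C then 1 else 0) * M u w := by
  simp only [dotProduct, mulVec, charVec, Set.indicator_apply, Finset.mul_sum]
  refine Finset.sum_congr rfl fun u _ => Finset.sum_congr rfl fun w _ => ?_
  ring

theorem weightEnumerator_image {V W : Type*} [Fintype V] [Fintype W] {d n : ℕ}
    {A : Fin (d + 1) → Matrix V V ℂ} {B : Fin (d + 1) → Matrix W W ℂ}
    {f : (Fin n → W) → Fin n → V} (hf : Function.Injective f)
    (h : ∀ r χ ψ k, A r (f χ k) (f ψ k) = B r (χ k) (ψ k)) (D : Set (Fin n → W)) :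
    weightEnumerator A (f '' D) = weightEnumerator B D := by
  classical
  unfold weightEnumerator
  rw [Set.ncard_image_of_injective D hf]
  congr 1
  refine Finset.sum_congr rfl fun α _ => ?_
  congr 2
  rw [charVec_dotProduct_mulVec, charVec_dotProduct_mulVec]
  have hsum : ∀ F : (Fin n → V) → ℂ, (∀ u ∉ f '' D, F u = 0) →
      ∑ u, F u = ∑ χ, F (f χ) := fun F hF =>
    (Fintype.sum_of_injective f hf _ _
      (fun u hu => hF u fun hu' => hu (Set.image_subset_range _ _ hu')) fun _ => rfl).symm
  rw [hsum _ fun u hu => by simp [hu]]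
  refine Finset.sum_congr rfl fun χ _ => ?_
  rw [hsum _ fun u hu => by simp [hu]]
  refine Finset.sum_congr rfl fun ψ _ => ?_
  have hrel : relCount A (f χ) (f ψ) = relCount B χ ψ := by
    funext r
    simp only [relCount, h]
  simp only [hf.mem_set_image, hammingMatrix, of_apply, hrel]

/-- The vector that counts the values of `i`. -/
def valueCount {d n : ℕ} (i : Fin n → Fin (d + 1)) : Fin (d + 1) → ℕ :=
  fun r => (Finset.univ.filter fun k => i k = r).card

/-! ### Additive sets, their duals, and the equality of enumerators -/

section

variable {Γ V : Type*} [AddCommGroup Γ] [AddAction Γ V] {n : ℕ}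

theorem exists_subgroup_dualSet (b : Fin n → V) (C : Set (Fin n → V)) :
    ∃ S : Subgroup (Fin n → AddChar Γ ℂ), ∀ χ, χ ∈ S ↔ χ ∈ dualSet Γ b C :=
  ⟨{ carrier := dualSet Γ b C
     mul_mem' := fun {χ ψ} hχ hψ g hg => by
      simp [Finset.prod_mul_distrib, hχ g hg, hψ g hg]
     one_mem' := fun g _ => by simp
     inv_mem' := fun {χ} hχ g hg => by
      simp only [Pi.inv_apply, AddChar.inv_apply', Finset.prod_inv_distrib, hχ g hg, inv_one] }, fun _ => Iff.rfl⟩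

-- For `ψ ∈ S`, right translation by `ψ⁻¹` preserves `S`, so the inner sum does not depend on `ψ`.
open Classical in
theorem sum_subgroup_mul_inv {G : Type*} [Group G] [Fintype G] (S : Subgroup G) (f : G → ℂ) :
    ∑ χ, ∑ ψ, (if χ ∈ S then (1 : ℂ) else 0) * (if ψ ∈ S then 1 else 0) * f (χ * ψ⁻¹) =
      (∑ ψ, if ψ ∈ S then (1 : ℂ) else 0) * ∑ χ, (if χ ∈ S then 1 else 0) * f χ := by
  rw [Finset.sum_comm, Finset.sum_mul]
  refine Finset.sum_congr rfl fun ψ _ => ?_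
  rw [Finset.mul_sum]
  refine Fintype.sum_equiv (Equiv.mulRight ψ⁻¹) _ _ fun χ => ?_
  rw [Equiv.coe_mulRight]
  by_cases hψ : ψ ∈ S
  · simp [hψ, S.mul_mem_cancel_right (S.inv_mem hψ)]
  · simp [hψ]

theorem sum_ite_mem_eq_ncard {W : Type*} [Fintype W] (C : Set W) [DecidablePred (· ∈ C)] :
    ∑ u, (if u ∈ C then (1 : ℂ) else 0) = C.ncard := by
  simp [Set.ncard_eq_toFinset_card']

open Classical in
theorem charVec_hammingMatrix_dualScheme [Fintype Γ] {d : ℕ} {E : Fin (d + 1) → Matrix V V ℂ}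
    (hinv : ∀ j, IsInvariant Γ (E j)) {o : V}
    {c : AddChar Γ ℂ → Fin (d + 1)} (hc : IsDualIndex o E c) (b : Fin n → V)
    (C : Set (Fin n → V)) (β : Fin (d + 1) → ℕ) :
    charVec (dualSet Γ b C) ⬝ᵥ (hammingMatrix n (dualScheme Γ o E) β *ᵥ charVec (dualSet Γ b C)) =
      (dualSet Γ b C).ncard * ∑ χ : Fin n → AddChar Γ ℂ, (if χ ∈ dualSet Γ b C then 1 else 0) *
        if valueCount (fun k => c (χ k)) = β then 1 else 0 := by
  obtain ⟨S, hS⟩ := exists_subgroup_dualSet (Γ := Γ) b C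
  rw [charVec_dotProduct_mulVec, ← sum_ite_mem_eq_ncard]
  simp only [← hS]
  rw [← sum_subgroup_mul_inv S fun χ => if valueCount (fun k => c (χ k)) = β then 1 else 0]
  have hrel (χ ψ : Fin n → AddChar Γ ℂ) :
      relCount (dualScheme Γ o E) χ ψ = valueCount fun k => c ((χ * ψ⁻¹) k) := by
    funext r
    simp [relCount, valueCount, dualScheme_apply hinv hc]
  simp only [hammingMatrix, of_apply, hrel]

open Classical in
theorem sum_addSubgroup_prod_addChar [Fintype Γ] (H : AddSubgroup (Fin n → Γ))
    (χ : Fin n → AddChar Γ ℂ) :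
    ∑ g : Fin n → Γ, (if g ∈ H then 1 else 0) * ∏ k, χ k (g k) =
      if ∀ g ∈ H, ∏ k, χ k (g k) = 1 then ∑ g, if g ∈ H then (1 : ℂ) else 0 else 0 := by
  split_ifs with h
  · refine Finset.sum_congr rfl fun g _ => ?_
    split_ifs with hg
    · rw [h g hg, mul_one]
    · rw [zero_mul]
  · push Not at h
    obtain ⟨g₀, hg₀, hne⟩ := h
    -- Translation by `g₀` permutes `H` and multiplies the sum by the value at `g₀`, which is not 1.
    refine eq_zero_of_mul_eq_self_left hne ?_
    rw [Finset.mul_sum]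
    refine Fintype.sum_equiv (Equiv.addLeft g₀) _ _ fun g => ?_
    simp only [Equiv.coe_addLeft, H.add_mem_cancel_left hg₀, Pi.add_apply,
      AddChar.map_add_eq_mul, Finset.prod_mul_distrib]
    ring

-- Fourier inversion in each coordinate; multiplying out gives a sum over tuples of characters.
open Classical in
theorem card_pow_mul_hammingIdempotent [Fintype Γ] [AddAction.IsPretransitive Γ V] {d : ℕ}
    {E : Fin (d + 1) → Matrix V V ℂ}
    (hinv : ∀ j, IsInvariant Γ (E j)) {o : V}
    {c : AddChar Γ ℂ → Fin (d + 1)} (hc : IsDualIndex o E c) (b : Fin n → V)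
    (β : Fin (d + 1) → ℕ) (g h : Fin n → Γ) :
    (Fintype.card Γ : ℂ) ^ n *
        hammingIdempotent n E β (fun k => g k +ᵥ b k) (fun k => h k +ᵥ b k) =
      ∑ χ : Fin n → AddChar Γ ℂ, (if valueCount (fun k => c (χ k)) = β then 1 else 0) *
        ((∏ k, χ k (g k)) * ∏ k, χ k (-h k)) := by
  have hentry : ∀ (i : Fin n → Fin (d + 1)),
      (Fintype.card Γ : ℂ) ^ n * ∏ k, E (i k) (g k +ᵥ b k) (h k +ᵥ b k) =
        ∑ χ : Fin n → AddChar Γ ℂ, (if (fun k => c (χ k)) = i then 1 else 0) *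
          ((∏ k, χ k (g k)) * ∏ k, χ k (-h k)) := by
    intro i
    have hcard : (Fintype.card Γ : ℂ) ^ n = ∏ _k : Fin n, (Fintype.card Γ : ℂ) := by simp
    rw [hcard, ← Finset.prod_mul_distrib]
    have : ∀ k, (Fintype.card Γ : ℂ) * E (i k) (g k +ᵥ b k) (h k +ᵥ b k) =
        ∑ χ : AddChar Γ ℂ, (if c χ = i k then 1 else 0) * (χ (g k) * χ (-h k)) := fun k => by
      rw [(hinv _).apply_vadd_vadd_base o, (hinv _).apply_vadd_vadd,
        card_mul_apply_eq_sum_fourierCoeff]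
      simp only [hc (i k), neg_sub]
      simp only [sub_eq_add_neg, AddChar.map_add_eq_mul]
    simp only [this, Fintype.prod_sum, Finset.prod_mul_distrib, Finset.prod_ite_zero,
      Finset.prod_const_one, funext_iff, Finset.mem_univ, true_imp_iff]
  rw [hammingIdempotent, Matrix.sum_apply, Finset.mul_sum]
  simp only [of_apply, hentry]
  rw [Finset.sum_comm]
  refine Finset.sum_congr rfl fun χ _ => ?_
  -- Each `χ` contributes to exactly one index tuple, namely `c ∘ χ`.
  rw [← Finset.sum_mul, Finset.sum_ite_eq]
  simp [valueCount, funext_iff]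

theorem IsAdditive.ncard_ne_zero [Fintype V] {b : Fin n → V} {C : Set (Fin n → V)}
    (hC : IsAdditive Γ b C) : C.ncard ≠ 0 := by
  obtain ⟨H, hH⟩ := hC
  exact ((Set.ncard_pos C.toFinite).2 ⟨_, (hH 0).1 H.zero_mem⟩).ne'

theorem vadd_pi_bijective [FaithfulVAdd Γ V] [AddAction.IsPretransitive Γ V] (b : Fin n → V) :
    Function.Bijective fun (g : Fin n → Γ) k => g k +ᵥ b k :=
  Function.Bijective.piMap fun k => vadd_bijective_of_faithful (b k)

open Classical in
theorem charVec_hammingIdempotent [Fintype Γ] [Fintype V] [FaithfulVAdd Γ V]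
    [AddAction.IsPretransitive Γ V] {d : ℕ} {E : Fin (d + 1) → Matrix V V ℂ}
    (hinv : ∀ j, IsInvariant Γ (E j)) {o : V}
    {c : AddChar Γ ℂ → Fin (d + 1)} (hc : IsDualIndex o E c) {b : Fin n → V}
    {C : Set (Fin n → V)} (hC : IsAdditive Γ b C) (β : Fin (d + 1) → ℕ) :
    (Fintype.card V : ℂ) ^ n * (charVec C ⬝ᵥ (hammingIdempotent n E β *ᵥ charVec C)) =
      (C.ncard : ℂ) ^ 2 * ∑ χ : Fin n → AddChar Γ ℂ, (if χ ∈ dualSet Γ b C then 1 else 0) *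
        if valueCount (fun k => c (χ k)) = β then 1 else 0 := by
  obtain ⟨H, hH⟩ := hC
  have hsum (F : (Fin n → V) → ℂ) := ((vadd_pi_bijective (Γ := Γ) b).sum_comp F).symm
  have hcard : (C.ncard : ℂ) = ∑ g, if g ∈ H then 1 else 0 := by
    rw [← sum_ite_mem_eq_ncard, hsum]
    simp only [hH]
  have hdual : ∀ χ, (∀ g ∈ H, ∏ k, χ k (g k) = 1) ↔ χ ∈ dualSet Γ b C := fun χ => by
    simp only [hH, dualSet, Set.mem_ofPred_eq]
  have hneg (χ : Fin n → AddChar Γ ℂ) : ∑ h : Fin n → Γ,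
      (if h ∈ H then 1 else 0) * ∏ k, χ k (-h k) =
        ∑ h : Fin n → Γ, (if h ∈ H then 1 else 0) * ∏ k, χ k (h k) :=
    Fintype.sum_equiv (Equiv.neg _) _ _ fun h => by simp
  rw [charVec_dotProduct_mulVec, hsum, card_eq_of_regular (Γ := Γ) o]
  simp only [hsum, ← hH, Finset.mul_sum]
  calc _ = ∑ g : Fin n → Γ, ∑ h : Fin n → Γ, ∑ χ : Fin n → AddChar Γ ℂ,
        (if valueCount (fun k => c (χ k)) = β then 1 else 0) *
          (((if g ∈ H then 1 else 0) * ∏ k, χ k (g k)) *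
            ((if h ∈ H then 1 else 0) * ∏ k, χ k (-h k))) := by
        refine Finset.sum_congr rfl fun g _ => Finset.sum_congr rfl fun h _ => ?_
        rw [mul_left_comm, card_pow_mul_hammingIdempotent hinv hc, Finset.mul_sum]
        exact Finset.sum_congr rfl fun χ _ => by ring
    _ = ∑ χ : Fin n → AddChar Γ ℂ, (if valueCount (fun k => c (χ k)) = β then 1 else 0) *
          ((∑ g : Fin n → Γ, (if g ∈ H then 1 else 0) * ∏ k, χ k (g k)) *
            ∑ h : Fin n → Γ, (if h ∈ H then 1 else 0) * ∏ k, χ k (-h k)) := by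
        simp only [Finset.sum_mul_sum]
        simp only [Finset.mul_sum]
        exact (Finset.sum_congr rfl fun g _ => Finset.sum_comm).trans Finset.sum_comm
    _ = _ := by
        refine Finset.sum_congr rfl fun χ _ => ?_
        -- Both character sums over `H` equal its order if `χ` is in the dual and vanish otherwise,
        -- hence the square.
        rw [hneg, sum_addSubgroup_prod_addChar, hcard]
        simp only [hdual]
        split_ifs <;> ring

theorem weightEnumerator_dualSet [Fintype Γ] [Fintype V] [FaithfulVAdd Γ V]
    [AddAction.IsPretransitive Γ V] {d : ℕ} {E : Fin (d + 1) → Matrix V V ℂ}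
    (hinv : ∀ j, IsInvariant Γ (E j)) {o : V}
    {c : AddChar Γ ℂ → Fin (d + 1)} (hc : IsDualIndex o E c) {b : Fin n → V}
    {C : Set (Fin n → V)} (hC : IsAdditive Γ b C) :
    weightEnumerator (dualScheme Γ o E) (dualSet Γ b C) = dualWeightEnumerator E C := by
  classical
  have hC0 : (C.ncard : ℂ) ≠ 0 := Nat.cast_ne_zero.2 hC.ncard_ne_zero
  -- The trivial tuple lies in the dual.
  have hD0 : ((dualSet Γ b C).ncard : ℂ) ≠ 0 := Nat.cast_ne_zero.2
    ((Set.ncard_pos (Set.toFinite _)).2 ⟨1, fun g _ => by simp⟩).ne'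
  unfold weightEnumerator dualWeightEnumerator
  rw [Finset.mul_sum, Finset.mul_sum]
  refine Finset.sum_congr rfl fun β _ => ?_
  rw [← mul_assoc, ← mul_assoc, ← map_mul, ← map_mul]
  congr 2
  rw [charVec_hammingMatrix_dualScheme hinv hc, one_div, inv_mul_cancel_left₀ hD0,
    div_mul_eq_mul_div, charVec_hammingIdempotent hinv hc hC,
    mul_div_cancel_left₀ _ (pow_ne_zero 2 hC0)]

theorem weightEnumerator_vertexSet [AddAction.IsPretransitive Γ V] [FaithfulVAdd Γ V] [Finite Γ]
    [Fintype V] {d : ℕ} {A E : Fin (d + 1) → Matrix V V ℂ}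
    (hΓ : ActsByAutomorphisms Γ A) {o : V} (b : Fin n → V) (φ : AddChar Γ ℂ ≃+ Γ)
    (hφ : ∀ j χ ψ, dualScheme Γ o E j χ ψ = A j (φ χ +ᵥ o) (φ ψ +ᵥ o))
    (D : Set (Fin n → AddChar Γ ℂ)) :
    weightEnumerator A (vertexSet b φ D) = weightEnumerator (dualScheme Γ o E) D := by
  refine weightEnumerator_image (f := fun χ k => φ (χ k) +ᵥ b k) ?_ (fun r χ ψ k => ?_) D
  · exact (vadd_pi_bijective (Γ := Γ) b).1.comp φ.injective.comp_left
  · have hr : IsInvariant Γ (A r) := fun g => hΓ g r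
    rw [hr.apply_vadd_vadd_base o, hφ]

end

end TranslationDuality

theorem mainTheorem8 {V Γ : Type*} [Fintype V] [AddCommGroup Γ] [Finite Γ] [AddAction Γ V]
    [FaithfulVAdd Γ V] [AddAction.IsPretransitive Γ V] {d : ℕ}
    (A E : Fin (d + 1) → Matrix V V ℂ)
    (hA : TranslationDuality.IsAssociationScheme A)
    (hE : TranslationDuality.IsPrincipalIdempotents A E)
    (hΓ : TranslationDuality.ActsByAutomorphisms Γ A)
    (o : V) :
    TranslationDuality.IsAssociationScheme (TranslationDuality.dualScheme Γ o E) ∧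
    ∀ (n : ℕ) (b : Fin n → V) (C : Set (Fin n → V)), TranslationDuality.IsAdditive Γ b C →
      TranslationDuality.weightEnumerator (TranslationDuality.dualScheme Γ o E)
          (TranslationDuality.dualSet Γ b C) =
        TranslationDuality.dualWeightEnumerator E C ∧
      ∀ φ : AddChar Γ ℂ ≃+ Γ,
        (∀ j χ ψ, TranslationDuality.dualScheme Γ o E j χ ψ =
          A j (φ χ +ᵥ o) (φ ψ +ᵥ o)) →
        TranslationDuality.weightEnumerator A
            (TranslationDuality.vertexSet b φ (TranslationDuality.dualSet Γ b C)) =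
          TranslationDuality.dualWeightEnumerator E C := by
  have := Fintype.ofFinite Γ
  obtain ⟨c, hc⟩ := hE.exists_isDualIndex hΓ o
  refine ⟨TranslationDuality.isAssociationScheme_dualScheme hA hE hΓ o, fun n b C hC => ?_⟩
  have h := TranslationDuality.weightEnumerator_dualSet (hE.isInvariant hΓ) hc hC
  exact ⟨h, fun φ hφ => (TranslationDuality.weightEnumerator_vertexSet hΓ b φ hφ _).trans h⟩
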